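/- Let $A$ be an $f$-algebra (a real vector lattice with an associative bilinear multiplication, not necessarily with unit, such that products of positive elements are positive and $a\wedge b=0$, $c\ge 0$ imply $(ca)\wedge b=(ac)\wedge b=0$). Let $A^{\sim}$ be its order dual, i.e. the vector lattice of all order bounded linear functionals on $A$, and assume that $A^{\sim}$ separates the points of $A$. Let $(A^{\sim})^{\sim}_{n}$ be the vector lattice of all order bounded, order continuous linear functionals on $A^{\sim}$, and for $x\in A$ let $x''\in(A^{\sim})^{\sim}_{n}$ be given by $x''(g)=g(x)$. For $f\in A^{\sim}$, $a\in A$ and $F\in(A^{\sim})^{\sim}_{n}$ define $f\cdot a\in A^{\sim}$ and $F\cdot f\in A^{\sim}$ by $$(f\cdot a)(b)=f(ab)\quad(b\in A),\qquad (F\cdot f)(a)=F(f\cdot a)\quad(a\in A),$$ and let $T_f:(A^{\sim})^{\sim}_{n}\to A^{\sim}$, $T_f(F)=F\cdot f$. Let $0\le f\in A^{\sim}$. Then $T_f$ is an interval preserving lattice homomorphism; that is, $T_f$ is linear and positive, $T_f[0,F]=[0,T_f(F)]$ for all $0\le F\in(A^{\sim})^{\sim}_{n}$, and $T_f(F\vee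 G)=T_f(F)\vee T_f(G)$, $T_f(F\wedge G)=T_f(F)\wedge T_f(G)$ for all $F,G\in(A^{\sim})^{\sim}_{n}$. Moreover, when $A$ is regarded as a subset of $(A^{\sim})^{\sim}_{n}$ through $x\mapsto x''$, the restriction of $T_f$ to $A$ is the map $S_f:A\to A^{\sim}$, $S_f(a)=f\cdot a$, that is, $T_f(a'')=f\cdot a$ for all $a\in A$; the operator $S_f$ is order bounded, and its order adjoint $S_f':(A^{\sim})^{\sim}\to A^{\sim}$, $S_f'(F)=F\circ S_f$, coincides with $T_f$ on $(A^{\sim})^{\sim}_{n}$. -/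

import Mathlib

/-
Riesz spaces (real vector lattices) `E` are given by the instances
`[AddCommGroup E] [Lattice E] [IsOrderedAddMonoid E] [Module ℝ E] [PosSMulMono ℝ E]`.
-/


universe u v

open Set Filter Topology

section OperatorNotions

variable {E : Type u} {F : Type v}

/-- An operator is order bounded if it maps order intervals into order intervals. -/
def IsOrderBounded [AddCommGroup E] [PartialOrder E] [Module ℝ E]
    [AddCommGroup F] [PartialOrder F] [Module ℝ F] (T : E →ₗ[ℝ] F) : Prop :=
  ∀ u v : E, ∃ w z : F, ∀ x ∈ Icc u v, T x ∈ Icc w z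

/-- Order convergence of the net `x` to `l`: there is a net `y`, decreasing with infimum `0`, on
the same index set, such that `|x i - l| ≤ y i` for all `i`. -/
def OrderConverges [AddCommGroup E] [Lattice E] {ι : Type*} [Preorder ι]
    (x : ι → E) (l : E) : Prop :=
  ∃ y : ι → E, Antitone y ∧ IsGLB (range y) 0 ∧ ∀ i, |x i - l| ≤ y i

/-- An operator is order continuous if it maps nets that are order convergent to `0` to nets that
are order convergent to `0`. -/
def IsOrderContinuous [AddCommGroup E] [Lattice E] [Module ℝ E]
    [AddCommGroup F] [Lattice F] [Module ℝ F] (T : E →ₗ[ℝ] F) : Prop :=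
  ∀ (ι : Type u) [Preorder ι] [IsDirectedOrder ι] [Nonempty ι] (x : ι → E),
    OrderConverges x 0 → OrderConverges (fun i => T (x i)) 0

/-- Lattice homomorphisms (Riesz homomorphisms). -/
structure IsLatticeHomomorphism [AddCommGroup E] [Lattice E] [Module ℝ E]
    [AddCommGroup F] [Lattice F] [Module ℝ F] (T : E →ₗ[ℝ] F) : Prop where
  map_sup : ∀ x y : E, T (x ⊔ y) = T x ⊔ T y
  map_inf : ∀ x y : E, T (x ⊓ y) = T x ⊓ T y

/-- `T` is positive and `T [0, x] = [0, T x]` for all `x ≥ 0`. -/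
structure IsIntervalPreserving [AddCommGroup E] [PartialOrder E] [Module ℝ E]
    [AddCommGroup F] [PartialOrder F] [Module ℝ F] (T : E →ₗ[ℝ] F) : Prop where
  nonneg : ∀ x : E, 0 ≤ x → 0 ≤ T x
  image_Icc : ∀ x : E, 0 ≤ x → T '' Icc 0 x = Icc 0 (T x)

end OperatorNotions

section OrdDualDefs

variable (E : Type u) [AddCommGroup E] [Lattice E] [IsOrderedAddMonoid E] [Module ℝ E]

/-- The order bounded linear functionals on `E`, as a subspace of the algebraic dual. -/
def orderBoundedFunctionals : Submodule ℝ (E →ₗ[ℝ] ℝ) where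
  carrier := {φ | IsOrderBounded φ}
  add_mem' := by
    intro φ ψ hφ hψ u v
    obtain ⟨w, z, h⟩ := hφ u v
    obtain ⟨w', z', h'⟩ := hψ u v
    exact ⟨w + w', z + z', fun x hx =>
      ⟨add_le_add (h x hx).1 (h' x hx).1, add_le_add (h x hx).2 (h' x hx).2⟩⟩
  zero_mem' := fun u v => ⟨0, 0, fun x _ => by simp⟩
  smul_mem' := by
    intro c φ hφ u v
    obtain ⟨w, z, h⟩ := hφ u v
    rcases le_total 0 c with hc | hc
    · exact ⟨c * w, c * z, fun x hx =>
        ⟨mul_le_mul_of_nonneg_left (h x hx).1 hc, mul_le_mul_of_nonneg_left (h x hx).2 hc⟩⟩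
    · exact ⟨c * z, c * w, fun x hx =>
        ⟨mul_le_mul_of_nonpos_left (h x hx).2 hc, mul_le_mul_of_nonpos_left (h x hx).1 hc⟩⟩

/-- The order dual `E~` of a Riesz space `E`: the order bounded linear functionals. -/
def OrdDual : Type u := ↥(orderBoundedFunctionals E)

noncomputable instance : AddCommGroup (OrdDual E) :=
  inferInstanceAs (AddCommGroup ↥(orderBoundedFunctionals E))

noncomputable instance : Module ℝ (OrdDual E) :=
  inferInstanceAs (Module ℝ ↥(orderBoundedFunctionals E))

end OrdDualDefs

namespace OrdDual

section Basic

variable {E : Type u} [AddCommGroup E] [Lattice E] [IsOrderedAddMonoid E] [Module ℝ E]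

/-- The underlying linear functional. -/
def toLin (φ : OrdDual E) : E →ₗ[ℝ] ℝ := φ.1

theorem isOrderBounded (φ : OrdDual E) : IsOrderBounded φ.toLin := φ.2

instance : CoeFun (OrdDual E) (fun _ => E → ℝ) := ⟨fun φ => φ.toLin⟩

/-- An order bounded linear functional as an element of the order dual. -/
def mk (φ : E →ₗ[ℝ] ℝ) (h : IsOrderBounded φ) : OrdDual E := ⟨φ, h⟩

@[simp] theorem mk_apply (φ : E →ₗ[ℝ] ℝ) (h : IsOrderBounded φ) (x : E) : mk φ h x = φ x := rfl
@[simp] theorem add_apply (φ ψ : OrdDual E) (x : E) : (φ + ψ) x = φ x + ψ x := rfl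
@[simp] theorem sub_apply (φ ψ : OrdDual E) (x : E) : (φ - ψ) x = φ x - ψ x := rfl
@[simp] theorem neg_apply (φ : OrdDual E) (x : E) : (-φ) x = - φ x := rfl
@[simp] theorem zero_apply (x : E) : (0 : OrdDual E) x = 0 := rfl
@[simp] theorem smul_apply (c : ℝ) (φ : OrdDual E) (x : E) : (c • φ) x = c * φ x := rfl

theorem decomp (φ : OrdDual E) (x : E) : φ x = φ x⁺ - φ x⁻ := by
  rw [← map_sub, posPart_sub_negPart]

theorem ext_nonneg {φ ψ : OrdDual E} (h : ∀ x, 0 ≤ x → φ x = ψ x) : φ = ψ := by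
  refine Subtype.ext (LinearMap.ext fun x => ?_)
  change φ x = ψ x
  rw [decomp φ, decomp ψ, h _ (posPart_nonneg x), h _ (negPart_nonneg x)]

/-- The order of the order dual: `φ ≤ ψ` iff `φ x ≤ ψ x` for all `x ≥ 0`. -/
instance : PartialOrder (OrdDual E) where
  le φ ψ := ∀ x : E, 0 ≤ x → φ x ≤ ψ x
  le_refl _ _ _ := le_rfl
  le_trans _ _ _ h h' x hx := (h x hx).trans (h' x hx)
  le_antisymm _ _ h h' := ext_nonneg fun x hx => le_antisymm (h x hx) (h' x hx)

theorem le_def {φ ψ : OrdDual E} : φ ≤ ψ ↔ ∀ x : E, 0 ≤ x → φ x ≤ ψ x := Iff.rfl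

instance : IsOrderedAddMonoid (OrdDual E) where
  add_le_add_left _ _ h _ x hx := by simpa using h x hx

instance : PosSMulMono ℝ (OrdDual E) where
  smul_le_smul_of_nonneg_left _ hc _ _ h x hx := mul_le_mul_of_nonneg_left (h x hx) hc

theorem mono {φ : OrdDual E} (hφ : 0 ≤ φ) {x y : E} (h : x ≤ y) : φ x ≤ φ y := by
  have := hφ (y - x) (sub_nonneg.2 h)
  simpa using this

end Basic

section Riesz

variable {E : Type u} [AddCommGroup E] [Lattice E] [IsOrderedAddMonoid E] [Module ℝ E]
  [PosSMulMono ℝ E]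

/-- An additive, positively homogeneous function on the positive cone extends to `E`. -/
theorem exists_extension (p : E → ℝ)
    (hadd : ∀ x y, 0 ≤ x → 0 ≤ y → p (x + y) = p x + p y)
    (hsmul : ∀ c : ℝ, ∀ x, 0 ≤ c → 0 ≤ x → p (c • x) = c * p x) :
    ∃ φ : E →ₗ[ℝ] ℝ, ∀ x, 0 ≤ x → φ x = p x := by
  have key : ∀ x a b : E, 0 ≤ a → 0 ≤ b → x = a - b → p x⁺ - p x⁻ = p a - p b := by
    intro x a b ha hb h
    have h1 : a + x⁻ = b + x⁺ := by
      have h2 := posPart_sub_negPart x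
      have h3 : x⁺ = a - b + x⁻ := by rw [← h]; exact sub_eq_iff_eq_add.1 h2
      rw [h3]; abel
    have h4 := hadd a x⁻ ha (negPart_nonneg x)
    have h5 := hadd b x⁺ hb (posPart_nonneg x)
    rw [h1] at h4
    linarith
  have hadd' : ∀ x y : E, p (x + y)⁺ - p (x + y)⁻ = p x⁺ - p x⁻ + (p y⁺ - p y⁻) := by
    intro x y
    rw [key (x + y) (x⁺ + y⁺) (x⁻ + y⁻) (add_nonneg (posPart_nonneg x) (posPart_nonneg y))
      (add_nonneg (negPart_nonneg x) (negPart_nonneg y)),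
      hadd _ _ (posPart_nonneg x) (posPart_nonneg y),
      hadd _ _ (negPart_nonneg x) (negPart_nonneg y)]
    · ring
    · conv_lhs => rw [← posPart_sub_negPart x, ← posPart_sub_negPart y]
      abel
  have hsmul' : ∀ (c : ℝ) (x : E), p (c • x)⁺ - p (c • x)⁻ = c * (p x⁺ - p x⁻) := by
    intro c x
    rcases le_total 0 c with hc | hc
    · rw [key (c • x) (c • x⁺) (c • x⁻) (smul_nonneg hc (posPart_nonneg x))
        (smul_nonneg hc (negPart_nonneg x)), hsmul _ _ hc (posPart_nonneg x),
        hsmul _ _ hc (negPart_nonneg x)]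
      · ring
      · rw [← smul_sub, posPart_sub_negPart]
    · have hc' : 0 ≤ -c := neg_nonneg.2 hc
      rw [key (c • x) ((-c) • x⁻) ((-c) • x⁺) (smul_nonneg hc' (negPart_nonneg x))
        (smul_nonneg hc' (posPart_nonneg x)), hsmul _ _ hc' (posPart_nonneg x),
        hsmul _ _ hc' (negPart_nonneg x)]
      · ring
      · conv_lhs => rw [← posPart_sub_negPart x]
        rw [← smul_sub, neg_smul, ← smul_neg, neg_sub]
  refine ⟨{ toFun := fun x => p x⁺ - p x⁻, map_add' := hadd', map_smul' := hsmul' }, ?_⟩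
  intro x hx
  change p x⁺ - p x⁻ = p x
  have h0 : p 0 = 0 := by simpa using hsmul 0 0 le_rfl le_rfl
  rw [key x x 0 hx le_rfl (by simp), h0, sub_zero]

/-- A positive linear functional is order bounded. -/
theorem isOrderBounded_of_nonneg (φ : E →ₗ[ℝ] ℝ) (h : ∀ x, 0 ≤ x → 0 ≤ φ x) :
    IsOrderBounded φ := fun u v => ⟨φ u, φ v, fun x hx => by
  have h1 := h (x - u) (sub_nonneg.2 hx.1)
  have h2 := h (v - x) (sub_nonneg.2 hx.2)
  rw [map_sub] at h1 h2
  exact ⟨by linarith, by linarith⟩⟩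

theorem bddAbove_image (φ : OrdDual E) (x : E) : BddAbove (φ '' Icc 0 x) := by
  obtain ⟨w, z, h⟩ := φ.isOrderBounded 0 x
  exact ⟨z, by rintro _ ⟨y, hy, rfl⟩; exact (h y hy).2⟩

/-- The Riesz-Kantorovich formula for the positive part of an order bounded functional. -/
theorem exists_pos (φ : OrdDual E) :
    ∃ ψ : OrdDual E, ∀ x, 0 ≤ x → ψ x = sSup (φ '' Icc 0 x) := by
  have hne : ∀ x : E, 0 ≤ x → (φ '' Icc 0 x).Nonempty := fun x hx =>
    ⟨φ 0, 0, ⟨le_rfl, hx⟩, rfl⟩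
  have hle : ∀ {x y : E}, 0 ≤ y → y ≤ x → φ y ≤ sSup (φ '' Icc 0 x) := fun {x y} h1 h2 =>
    le_csSup (bddAbove_image φ x) ⟨y, ⟨h1, h2⟩, rfl⟩
  obtain ⟨ψ, hψ⟩ := exists_extension (fun x => sSup (φ '' Icc 0 x))
    (by
      intro x y hx hy
      apply le_antisymm
      · apply csSup_le (hne _ (add_nonneg hx hy))
        rintro _ ⟨z, ⟨hz0, hz⟩, rfl⟩
        have h1 : φ (z ⊓ x) ≤ _ := hle (le_inf hz0 hx) inf_le_right
        have h2 : φ (z - z ⊓ x) ≤ sSup (φ '' Icc 0 y) := by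
          apply hle (sub_nonneg.2 inf_le_left)
          rw [sub_le_iff_le_add, ← sub_le_iff_le_add']
          refine le_inf ?_ ?_
          · exact sub_le_self _ hy
          · exact sub_le_iff_le_add.2 hz
        rw [map_sub] at h2
        change φ z ≤ _
        linarith
      · rw [← le_sub_iff_add_le]
        apply csSup_le (hne _ hx)
        rintro _ ⟨a, ⟨ha0, ha⟩, rfl⟩
        rw [le_sub_comm]
        apply csSup_le (hne _ hy)
        rintro _ ⟨b, ⟨hb0, hb⟩, rfl⟩
        have : φ (a + b) ≤ sSup (φ '' Icc 0 (x + y)) :=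
          hle (add_nonneg ha0 hb0) (add_le_add ha hb)
        rw [map_add] at this
        linarith)
    (by
      intro c x hc hx
      have aux : ∀ (c : ℝ) (x : E), 0 ≤ c → 0 ≤ x →
          c * sSup (φ '' Icc 0 x) ≤ sSup (φ '' Icc 0 (c • x)) := by
        intro c x hc hx
        rcases hc.eq_or_lt with rfl | hc'
        · rw [zero_mul]
          exact (map_zero φ.toLin).ge.trans
            (hle (x := (0 : ℝ) • x) (y := 0) le_rfl (by rw [zero_smul]))
        · rw [← le_div_iff₀' hc']
          apply csSup_le (hne _ hx)
          rintro _ ⟨a, ⟨ha0, ha⟩, rfl⟩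
          rw [le_div_iff₀' hc']
          have : φ (c • a) ≤ sSup (φ '' Icc 0 (c • x)) :=
            hle (smul_nonneg hc ha0) (smul_le_smul_of_nonneg_left ha hc)
          rwa [map_smul] at this
      refine le_antisymm ?_ (aux c x hc hx)
      rcases hc.eq_or_lt with rfl | hc'
      · simp
      · have := aux c⁻¹ (c • x) (inv_nonneg.2 hc) (smul_nonneg hc hx)
        rw [smul_smul, inv_mul_cancel₀ hc'.ne', one_smul] at this
        rwa [inv_mul_le_iff₀ hc'] at this)
  refine ⟨mk ψ (isOrderBounded_of_nonneg ψ fun x hx => ?_), hψ⟩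
  rw [hψ x hx]
  simpa using hle (x := x) (y := 0) le_rfl hx

/-- The positive part of an order bounded functional. -/
noncomputable def pos (φ : OrdDual E) : OrdDual E := (exists_pos φ).choose

theorem pos_apply (φ : OrdDual E) {x : E} (hx : 0 ≤ x) : pos φ x = sSup (φ '' Icc 0 x) :=
  (exists_pos φ).choose_spec x hx

theorem le_pos_apply (φ : OrdDual E) {x y : E} (hy : 0 ≤ y) (h : y ≤ x) : φ y ≤ pos φ x := by
  rw [pos_apply φ (hy.trans h)]
  exact le_csSup (bddAbove_image φ x) ⟨y, ⟨hy, h⟩, rfl⟩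

theorem pos_apply_le (φ : OrdDual E) {x : E} (hx : 0 ≤ x) {c : ℝ}
    (h : ∀ y, 0 ≤ y → y ≤ x → φ y ≤ c) : pos φ x ≤ c := by
  rw [pos_apply φ hx]
  refine csSup_le ⟨φ 0, 0, ⟨le_rfl, hx⟩, rfl⟩ ?_
  rintro _ ⟨y, hy, rfl⟩
  exact h y hy.1 hy.2

theorem pos_nonneg (φ : OrdDual E) : 0 ≤ pos φ := fun x hx => by
  simpa using le_pos_apply φ (le_refl (0 : E)) hx

/-- The order dual of a Riesz space is a lattice. -/
noncomputable instance : Lattice (OrdDual E) where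
  sup φ ψ := ψ + pos (φ - ψ)
  inf φ ψ := φ - pos (φ - ψ)
  le_sup_left φ ψ x hx := by
    have := le_pos_apply (φ - ψ) hx le_rfl
    simp only [sub_apply, add_apply] at *
    linarith
  le_sup_right φ ψ x hx := by
    have := pos_nonneg (φ - ψ) x hx
    simp only [add_apply, zero_apply] at *
    linarith
  sup_le φ ψ χ h1 h2 x hx := by
    have : pos (φ - ψ) x ≤ χ x - ψ x := by
      refine pos_apply_le _ hx fun y hy hyx => ?_
      have h3 := h1 y hy
      have h4 := h2 (x - y) (sub_nonneg.2 hyx)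
      simp only [sub_apply, map_sub] at *
      linarith
    simp only [add_apply]
    linarith
  inf_le_left φ ψ x hx := by
    have := pos_nonneg (φ - ψ) x hx
    simp only [sub_apply, zero_apply] at *
    linarith
  inf_le_right φ ψ x hx := by
    have := le_pos_apply (φ - ψ) hx le_rfl
    simp only [sub_apply] at *
    linarith
  le_inf χ φ ψ h1 h2 x hx := by
    have : pos (φ - ψ) x ≤ φ x - χ x := by
      refine pos_apply_le _ hx fun y hy hyx => ?_
      have h3 := h2 y hy
      have h4 := h1 (x - y) (sub_nonneg.2 hyx)
      simp only [sub_apply, map_sub] at *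
      linarith
    simp only [sub_apply]
    linarith

theorem sup_eq (φ ψ : OrdDual E) : φ ⊔ ψ = ψ + pos (φ - ψ) := rfl
theorem inf_eq (φ ψ : OrdDual E) : φ ⊓ ψ = φ - pos (φ - ψ) := rfl

theorem abs_apply_le (φ : OrdDual E) (x : E) : |φ x| ≤ |φ| |x| := by
  have h : ∀ ψ : OrdDual E, ψ ≤ |φ| → -ψ ≤ |φ| → ψ x ≤ |φ| |x| := by
    intro ψ h1 h2
    have e1 := h1 x⁺ (posPart_nonneg x)
    have e2 := h2 x⁻ (negPart_nonneg x)
    rw [decomp ψ, ← posPart_add_negPart x, map_add]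
    simp only [neg_apply] at e2
    linarith
  rw [abs_le']
  refine ⟨h φ (le_abs_self φ) (neg_le_abs φ), ?_⟩
  exact h (-φ) (neg_le_abs φ) (by rw [neg_neg]; exact le_abs_self φ)

end Riesz

end OrdDual

section Adjoint

variable {E : Type u} {F : Type v} [AddCommGroup E] [Lattice E] [IsOrderedAddMonoid E]
  [Module ℝ E] [AddCommGroup F] [Lattice F] [IsOrderedAddMonoid F] [Module ℝ F]

/-- The order adjoint `T' : F~ → E~`, `T' φ = φ ∘ T`, of an order bounded operator `T`. -/
noncomputable def orderAdjoint (T : E →ₗ[ℝ] F) (hT : IsOrderBounded T) : OrdDual F →ₗ[ℝ] OrdDual E where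
  toFun φ := OrdDual.mk (φ.toLin ∘ₗ T) fun u v => by
    obtain ⟨w, z, h⟩ := hT u v
    obtain ⟨w', z', h'⟩ := φ.isOrderBounded w z
    exact ⟨w', z', fun x hx => h' _ (h x hx)⟩
  map_add' _ _ := rfl
  map_smul' _ _ := rfl

end Adjoint

section OCont

variable (E : Type u) [AddCommGroup E] [Lattice E] [IsOrderedAddMonoid E] [Module ℝ E]

/-- The order continuous functionals among the order bounded ones. -/
def orderContinuousFunctionals : Submodule ℝ (OrdDual E) where
  carrier := {φ | IsOrderContinuous φ.toLin}
  add_mem' := by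
    intro φ ψ hφ hψ ι _ _ _ x hx
    obtain ⟨y, hy, hy0, hxy⟩ := hφ ι x hx
    obtain ⟨z, hz, hz0, hxz⟩ := hψ ι x hx
    refine ⟨y + z, hy.add hz, ⟨?_, ?_⟩, fun i => ?_⟩
    · rintro _ ⟨i, rfl⟩
      exact add_nonneg (hy0.1 ⟨i, rfl⟩) (hz0.1 ⟨i, rfl⟩)
    · intro c hc
      by_contra h
      push Not at h
      have h1 : ∃ i, y i < c / 2 := by
        by_contra! h'
        have : c / 2 ≤ 0 := hy0.2 (by rintro _ ⟨i, rfl⟩; exact h' i)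
        linarith
      have h2 : ∃ i, z i < c / 2 := by
        by_contra! h'
        have : c / 2 ≤ 0 := hz0.2 (by rintro _ ⟨i, rfl⟩; exact h' i)
        linarith
      obtain ⟨i, hi⟩ := h1
      obtain ⟨j, hj⟩ := h2
      obtain ⟨k, hik, hjk⟩ := exists_ge_ge i j
      have h3 : c ≤ y k + z k := hc ⟨k, rfl⟩
      have := hy hik
      have := hz hjk
      linarith
    · have h1 := hxy i
      have h2 := hxz i
      simp only [sub_zero] at *
      exact (abs_add_le _ _).trans (add_le_add h1 h2)
  zero_mem' := by
    intro ι _ _ _ x _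
    refine ⟨fun _ => 0, antitone_const, ?_, fun i => ?_⟩
    · simp
    · change |(0 : ℝ) - 0| ≤ 0
      simp
  smul_mem' := by
    intro c φ hφ ι _ _ _ x hx
    obtain ⟨y, hy, hy0, hxy⟩ := hφ ι x hx
    refine ⟨fun i => |c| * y i, fun i j h => mul_le_mul_of_nonneg_left (hy h) (abs_nonneg c),
      ⟨?_, ?_⟩, fun i => ?_⟩
    · rintro _ ⟨i, rfl⟩
      exact mul_nonneg (abs_nonneg c) (hy0.1 ⟨i, rfl⟩)
    · intro d hd
      rcases (abs_nonneg c).eq_or_lt with h | h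
      · have := hd ⟨Classical.arbitrary ι, rfl⟩
        simpa [← h] using this
      · have : d / |c| ≤ 0 := hy0.2 (by
          rintro _ ⟨i, rfl⟩
          rw [div_le_iff₀' h]
          exact hd ⟨i, rfl⟩)
        rw [div_le_iff₀ h] at this
        simpa using this
    · have h1 := hxy i
      simp only [sub_zero] at *
      change |c * φ (x i)| ≤ _
      rw [abs_mul]
      exact mul_le_mul_of_nonneg_left h1 (abs_nonneg c)

/-- The order continuous dual `E~_n`: the order bounded functionals on `E` that are order
continuous. -/
def OrdContDual : Type u := ↥(orderContinuousFunctionals E)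

noncomputable instance : AddCommGroup (OrdContDual E) :=
  inferInstanceAs (AddCommGroup ↥(orderContinuousFunctionals E))

noncomputable instance : Module ℝ (OrdContDual E) :=
  inferInstanceAs (Module ℝ ↥(orderContinuousFunctionals E))

/-- The inclusion of `E~_n` in `E~`. -/
noncomputable def OrdContDual.incl : OrdContDual E →ₗ[ℝ] OrdDual E := (orderContinuousFunctionals E).subtype

/-- The order that `E~_n` inherits from `E~`. -/
instance : PartialOrder (OrdContDual E) :=
  inferInstanceAs (PartialOrder {φ : OrdDual E // φ ∈ orderContinuousFunctionals E})

instance : IsOrderedAddMonoid (OrdContDual E) where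
  add_le_add_left φ ψ h χ := by
    have h' : φ.1 ≤ ψ.1 := h
    exact add_le_add_left h' χ.1

instance : PosSMulMono ℝ (OrdContDual E) where
  smul_le_smul_of_nonneg_left c hc φ ψ h := by
    have h' : φ.1 ≤ ψ.1 := h
    have h'' : c • φ.1 ≤ c • ψ.1 := smul_le_smul_of_nonneg_left h' hc
    exact h''

variable {E}

theorem OrdDual.pos_mem_orderContinuous [PosSMulMono ℝ E] (φ : OrdDual E)
    (hφ : φ ∈ orderContinuousFunctionals E) :
    OrdDual.pos φ ∈ orderContinuousFunctionals E := by
  intro ι _ _ _ x hx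
  obtain ⟨y, hy, hy0, hxy⟩ := hx
  have hynn : ∀ i, 0 ≤ y i := fun i => hy0.1 ⟨i, rfl⟩
  refine ⟨fun i => pos φ (y i), fun i j h => mono (pos_nonneg φ) (hy h), ⟨?_, ?_⟩, fun i => ?_⟩
  · rintro _ ⟨i, rfl⟩
    exact pos_nonneg φ _ (hynn i)
  · intro c hc
    have hc' : ∀ i, c ≤ pos φ (y i) := fun i => hc ⟨i, rfl⟩
    obtain ⟨i₀⟩ := ‹Nonempty ι›
    by_contra h
    push Not at h
    -- approximate the value at the starting index by an element of the interval
    have h1 : ∃ a, 0 ≤ a ∧ a ≤ y i₀ ∧ pos φ (y i₀) - c / 2 < φ a := by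
      by_contra! h'
      have := pos_apply_le φ (hynn i₀) h'
      linarith
    obtain ⟨a, ha0, ha, hφa⟩ := h1
    have hconv : OrderConverges (fun i => a ⊓ y i) 0 := by
      refine ⟨y, hy, hy0, fun i => ?_⟩
      rw [sub_zero, abs_of_nonneg (le_inf ha0 (hynn i))]
      exact inf_le_right
    obtain ⟨z, hz, hz0, haz⟩ := hφ ι _ hconv
    have h2 : ∃ i, z i < c / 2 := by
      by_contra! h'
      have : c / 2 ≤ 0 := hz0.2 (by rintro _ ⟨i, rfl⟩; exact h' i)
      linarith
    obtain ⟨i, hi⟩ := h2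
    obtain ⟨k, hik, hk⟩ := exists_ge_ge i i₀
    have e1 := haz k
    rw [sub_zero] at e1
    have e1' : φ (a ⊓ y k) ≤ z k := (le_abs_self _).trans e1
    have e2 := hz hik
    have e3 : φ (a - a ⊓ y k) ≤ pos φ (y i₀ - y k) := by
      apply le_pos_apply φ (sub_nonneg.2 inf_le_left)
      rw [sub_le_iff_le_add, ← sub_le_iff_le_add']
      refine le_inf ?_ ?_
      · exact sub_le_self _ (sub_nonneg.2 (hy hk))
      · rw [sub_le_iff_le_add]
        simpa using ha
    rw [map_sub, map_sub] at e3
    have e4 := hc' k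
    linarith
  · rw [sub_zero]
    have h1 := hxy i
    rw [sub_zero] at h1
    refine abs_le.2 ⟨?_, mono (pos_nonneg φ) ((le_abs_self _).trans h1)⟩
    have := mono (pos_nonneg φ) ((neg_le_abs (x i)).trans h1)
    rw [map_neg] at this
    change - pos φ (y i) ≤ pos φ (x i)
    linarith

/-- `E~_n` is a sublattice of `E~`, and carries the lattice operations of `E~`. -/
noncomputable instance [PosSMulMono ℝ E] : Lattice (OrdContDual E) where
  sup φ ψ := ⟨φ.1 ⊔ ψ.1, Submodule.add_mem _ ψ.2
    (OrdDual.pos_mem_orderContinuous _ (Submodule.sub_mem _ φ.2 ψ.2))⟩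
  inf φ ψ := ⟨φ.1 ⊓ ψ.1, Submodule.sub_mem _ φ.2
    (OrdDual.pos_mem_orderContinuous _ (Submodule.sub_mem _ φ.2 ψ.2))⟩
  le_sup_left φ ψ := le_sup_left (a := φ.1) (b := ψ.1)
  le_sup_right φ ψ := le_sup_right (a := φ.1) (b := ψ.1)
  sup_le φ ψ χ h1 h2 := sup_le (a := φ.1) (b := ψ.1) (c := χ.1) h1 h2
  inf_le_left φ ψ := inf_le_left (a := φ.1) (b := ψ.1)
  inf_le_right φ ψ := inf_le_right (a := φ.1) (b := ψ.1)
  le_inf φ ψ χ h1 h2 := le_inf (c := φ.1) (a := ψ.1) (b := χ.1) h1 h2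

end OCont

section Canonical

variable {E : Type u} [AddCommGroup E] [Lattice E] [IsOrderedAddMonoid E] [Module ℝ E]
  [PosSMulMono ℝ E]

theorem isOrderBounded_eval (x : E) :
    IsOrderBounded ({ toFun := fun φ => φ x, map_add' := fun _ _ => rfl,
                      map_smul' := fun _ _ => rfl } : OrdDual E →ₗ[ℝ] ℝ) := by
  intro φ ψ
  refine ⟨φ x⁺ - ψ x⁻, ψ x⁺ - φ x⁻, fun χ hχ => ?_⟩
  change χ x ∈ _
  rw [OrdDual.decomp χ]
  exact ⟨sub_le_sub (hχ.1 _ (posPart_nonneg x)) (hχ.2 _ (negPart_nonneg x)),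
    sub_le_sub (hχ.2 _ (posPart_nonneg x)) (hχ.1 _ (negPart_nonneg x))⟩

/-- A downward directed net in the order dual with infimum `0` converges pointwise to `0` on the
positive cone. -/
theorem OrdDual.isGLB_apply {ι : Type*} [Preorder ι] [IsDirectedOrder ι] [Nonempty ι]
    (y : ι → OrdDual E) (hy : Antitone y) (hy0 : IsGLB (range y) 0) (x : E) (hx : 0 ≤ x) :
    IsGLB (range fun i => y i x) 0 := by
  have hnn : ∀ i, 0 ≤ y i := fun i => hy0.1 ⟨i, rfl⟩
  have hbdd : ∀ x : E, 0 ≤ x → BddBelow (range fun i => y i x) := fun x hx =>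
    ⟨0, by rintro _ ⟨i, rfl⟩; exact hnn i x hx⟩
  have hanti : ∀ x : E, 0 ≤ x → Antitone fun i => y i x := fun x hx i j h => hy h x hx
  have hlim : ∀ x : E, 0 ≤ x → Tendsto (fun i => y i x) atTop (𝓝 (⨅ i, y i x)) := fun x hx =>
    tendsto_atTop_ciInf (hanti x hx) (hbdd x hx)
  obtain ⟨φ, hφ⟩ := OrdDual.exists_extension (fun x => ⨅ i, y i x)
    (by
      intro a b ha hb
      refine tendsto_nhds_unique (hlim _ (add_nonneg ha hb)) ?_
      simpa using (hlim a ha).add (hlim b hb))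
    (by
      intro c a hc ha
      refine tendsto_nhds_unique (hlim _ (smul_nonneg hc ha)) ?_
      simpa using (hlim a ha).const_mul c)
  have hφb : IsOrderBounded φ := OrdDual.isOrderBounded_of_nonneg φ fun a ha => by
    rw [hφ a ha]
    exact le_ciInf fun i => hnn i a ha
  have h1 : OrdDual.mk φ hφb ≤ 0 := hy0.2 (by
    rintro _ ⟨i, rfl⟩ a ha
    change φ a ≤ y i a
    rw [hφ a ha]
    exact ciInf_le (hbdd a ha) i)
  have h2 : φ x ≤ 0 := h1 x hx
  rw [hφ x hx] at h2
  refine ⟨by rintro _ ⟨i, rfl⟩; exact hnn i x hx, fun c hc => ?_⟩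
  exact (le_ciInf fun i => hc ⟨i, rfl⟩).trans h2

/-- The canonical embedding `x ↦ x''` of `E` in `(E~)~_n`, given by `x'' φ = φ x`. -/
noncomputable def canonicalEmbedding : E →ₗ[ℝ] OrdContDual (OrdDual E) where
  toFun x := ⟨OrdDual.mk { toFun := fun φ => φ x, map_add' := fun _ _ => rfl,
                           map_smul' := fun _ _ => rfl } (isOrderBounded_eval x), by
    intro ι _ _ _ f hf
    obtain ⟨y, hy, hy0, hfy⟩ := hf
    refine ⟨fun i => y i |x|, fun i j h => hy h _ (abs_nonneg x),
      OrdDual.isGLB_apply y hy hy0 _ (abs_nonneg x), fun i => ?_⟩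
    rw [sub_zero]
    have h1 := hfy i
    rw [sub_zero] at h1
    exact (OrdDual.abs_apply_le (f i) x).trans (h1 _ (abs_nonneg x))⟩
  map_add' x y := Subtype.ext (Subtype.ext (LinearMap.ext fun φ => map_add φ.toLin x y))
  map_smul' c x := Subtype.ext (Subtype.ext (LinearMap.ext fun φ => map_smul φ.toLin c x))

end Canonical

/-- An `f`-algebra: a Riesz space with an associative bilinear multiplication (no unit is assumed,
and commutativity is not part of the definition) such that products of positive elements are
positive, and `a ⊓ b = 0` with `c ≥ 0` implies `(c * a) ⊓ b = 0` and `(a * c) ⊓ b = 0`. -/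
class FAlgebra (A : Type u) [NonUnitalRing A] [Lattice A] [Module ℝ A] : Prop
    extends IsOrderedAddMonoid A, PosSMulMono ℝ A, IsScalarTower ℝ A A, SMulCommClass ℝ A A where
  mul_nonneg : ∀ a b : A, 0 ≤ a → 0 ≤ b → 0 ≤ a * b
  mul_inf_eq_zero : ∀ a b c : A, a ⊓ b = 0 → 0 ≤ c → (c * a) ⊓ b = 0
  inf_mul_eq_zero : ∀ a b c : A, a ⊓ b = 0 → 0 ≤ c → (a * c) ⊓ b = 0

/-- The order dual of `E` separates the points of `E`, i.e. `°(E~) = {0}`. -/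
def HasSeparatingOrderDual (E : Type u) [AddCommGroup E] [Lattice E] [IsOrderedAddMonoid E]
    [Module ℝ E] : Prop :=
  ∀ x : E, (∀ φ : OrdDual E, φ x = 0) → x = 0

section Products

variable {A : Type u} [NonUnitalRing A] [Lattice A] [Module ℝ A] [FAlgebra A]

theorem isOrderBounded_mulLeft (a : A) : IsOrderBounded (LinearMap.mulLeft ℝ a) := by
  intro u v
  refine ⟨a⁺ * u - a⁻ * v, a⁺ * v - a⁻ * u, fun x hx => ?_⟩
  have hm : ∀ {c x y : A}, 0 ≤ c → x ≤ y → c * x ≤ c * y := fun {c x y} hc h => by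
    have := FAlgebra.mul_nonneg c (y - x) hc (sub_nonneg.2 h)
    rwa [mul_sub, sub_nonneg] at this
  have : LinearMap.mulLeft ℝ a x = a⁺ * x - a⁻ * x := by
    rw [← sub_mul, posPart_sub_negPart, LinearMap.mulLeft_apply]
  rw [this]
  exact ⟨sub_le_sub (hm (posPart_nonneg a) hx.1) (hm (negPart_nonneg a) hx.2),
    sub_le_sub (hm (posPart_nonneg a) hx.2) (hm (negPart_nonneg a) hx.1)⟩

/-- `f · a ∈ A~` for `f ∈ A~` and `a ∈ A`: `(f · a) b = f (a * b)`. -/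
def dualMul (f : OrdDual A) (a : A) : OrdDual A :=
  OrdDual.mk (f.toLin ∘ₗ LinearMap.mulLeft ℝ a) fun u v => by
    obtain ⟨w, z, h⟩ := isOrderBounded_mulLeft a u v
    obtain ⟨w', z', h'⟩ := f.isOrderBounded w z
    exact ⟨w', z', fun x hx => h' _ (h x hx)⟩

theorem dualMul_apply (f : OrdDual A) (a b : A) : dualMul f a b = f (a * b) := rfl

/-- The operator `A → A~`, `a ↦ f · a`. -/
noncomputable def dualMulMap (f : OrdDual A) : A →ₗ[ℝ] OrdDual A where
  toFun a := dualMul f a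
  map_add' a b := OrdDual.ext_nonneg fun x _ => by
    rw [OrdDual.add_apply]
    simp only [dualMul_apply]
    rw [add_mul, map_add]
  map_smul' c a := OrdDual.ext_nonneg fun x _ => by
    rw [RingHom.id_apply, OrdDual.smul_apply]
    simp only [dualMul_apply]
    rw [smul_mul_assoc, map_smul, smul_eq_mul]

theorem isOrderBounded_dualMulMap (f : OrdDual A) : IsOrderBounded (dualMulMap f) := by
  intro u v
  have hm : ∀ (g : OrdDual A), 0 ≤ g → ∀ {a b : A}, a ≤ b → dualMul g a ≤ dualMul g b := by
    intro g hg a b h x hx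
    rw [dualMul_apply, dualMul_apply]
    apply OrdDual.mono hg
    have := FAlgebra.mul_nonneg (b - a) x (sub_nonneg.2 h) hx
    rwa [sub_mul, sub_nonneg] at this
  refine ⟨dualMul f⁺ u - dualMul f⁻ v, dualMul f⁺ v - dualMul f⁻ u, fun a ha => ?_⟩
  have : dualMulMap f a = dualMul f⁺ a - dualMul f⁻ a := OrdDual.ext_nonneg fun x _ => by
    rw [OrdDual.sub_apply, dualMul_apply, dualMul_apply, ← OrdDual.sub_apply, posPart_sub_negPart]
    rfl
  rw [this]
  exact ⟨sub_le_sub (hm _ (posPart_nonneg f) ha.1) (hm _ (negPart_nonneg f) ha.2),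
    sub_le_sub (hm _ (posPart_nonneg f) ha.2) (hm _ (negPart_nonneg f) ha.1)⟩

/-- `F · f ∈ A~` for `F ∈ (A~)~_n` and `f ∈ A~`: `(F · f) a = F (f · a)`. -/
noncomputable def bidualMul (F : OrdContDual (OrdDual A)) (f : OrdDual A) : OrdDual A :=
  OrdDual.mk
    { toFun := fun a => OrdContDual.incl _ F (dualMul f a)
      map_add' := fun a b => by
        have := map_add (dualMulMap f) a b
        change dualMul f (a + b) = dualMul f a + dualMul f b at this
        rw [this, map_add]
      map_smul' := fun c a => by
        have := map_smul (dualMulMap f) c a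
        change dualMul f (c • a) = c • dualMul f a at this
        rw [this, map_smul, RingHom.id_apply] }
    fun u v => by
      obtain ⟨w, z, h⟩ := isOrderBounded_dualMulMap f u v
      obtain ⟨w', z', h'⟩ := (OrdContDual.incl _ F).isOrderBounded w z
      exact ⟨w', z', fun x hx => h' _ (h x hx)⟩

theorem bidualMul_apply (F : OrdContDual (OrdDual A)) (f : OrdDual A) (a : A) :
    bidualMul F f a = OrdContDual.incl _ F (dualMul f a) := rfl

/-- The operator `T_f : (A~)~_n → A~`, `T_f F = F · f`. -/
noncomputable def bidualMulMap (f : OrdDual A) : OrdContDual (OrdDual A) →ₗ[ℝ] OrdDual A where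
  toFun F := bidualMul F f
  map_add' _ _ := rfl
  map_smul' _ _ := rfl

end Products

/-!
By definition `T_f` is the restriction of the order adjoint of `S_f`, and `T_f(a'') = f·a` says that
`f(ba) = f(ab)`. The positive bilinear form `(a, b) ↦ f(ab)` vanishes on disjoint pairs, and cutting
`b` into slices of height `e` shows that every such form is symmetric.

Since `S_f` is a lattice homomorphism, a functional `0 ≤ g ≤ S_f'(φ)` factors through the range of
`S_f`, where it is dominated by the sublinear functional `y ↦ φ(y⁺)`. Hahn–Banach extends it to a
`ψ` with `0 ≤ ψ ≤ φ` and `S_f'(ψ) = g`, and `ψ` inherits order continuity from `φ`.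

For disjoint `F` and `G`, write `f = g + h` with `F(g)` and `G(h)` small. Left multiplication by
`a ≥ 0` and its order adjoint are positive orthomorphisms, and every positive orthomorphism
satisfies `c T ≤ (c² + c) I + T²` for all `c ≥ 0`. Hence `(F·g)(a)` and `(G·h)(a)` are small as
well. What remains, up to `2 F·g + 2 G·h`, is `F·(h - g)⁺ ⊓ G·(g - h)⁺`. This vanishes because `F·p`
is disjoint from `q` whenever `p` is, and here the order continuity of `F` enters.
-/

section RieszSpace

variable {E : Type u} [AddCommGroup E] [Lattice E] [IsOrderedAddMonoid E]

theorem le_of_le_add_of_inf_eq_zero {x y z : E} (hy : 0 ≤ y) (h : x ≤ y + z) (hxz : x ⊓ z = 0) :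
    x ≤ y :=
  sub_nonpos.1 <| (le_inf (sub_le_self x hy) (sub_le_iff_le_add'.2 h)).trans_eq hxz

theorem inf_eq_zero_of_le_of_le {α : Type*} [SemilatticeInf α] [Zero α] {x y x' y' : α}
    (hx : 0 ≤ x) (hy : 0 ≤ y) (hxx' : x ≤ x') (hyy' : y ≤ y') (h : x' ⊓ y' = 0) : x ⊓ y = 0 :=
  le_antisymm ((inf_le_inf hxx' hyy').trans_eq h) (le_inf hx hy)

theorem posPart_sub_inf_posPart_sub_eq_zero (x y : E) : (x - y)⁺ ⊓ (y - x)⁺ = 0 := by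
  rw [← neg_sub x y, posPart_neg, posPart_inf_negPart_eq_zero]

theorem sub_inf_eq_posPart_sub (x y : E) : x - x ⊓ y = (x - y)⁺ := by
  rw [inf_eq_sub_posPart_sub, sub_sub_cancel]

theorem posPart_posPart_sub {x e : E} (he : 0 ≤ e) : (x⁺ - e)⁺ = (x - e)⁺ := by
  have : -e ≤ 0 := neg_nonpos.2 he
  rw [posPart_def, posPart_def, posPart_def, sup_sub, zero_sub, sup_assoc, sup_eq_right.2 this]

theorem inf_posPart_eq_posPart_sub_posPart {e : E} (he : 0 ≤ e) (t : E) :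
    e ⊓ t⁺ = t⁺ - (t - e)⁺ := by
  rw [← posPart_posPart_sub he, inf_comm, inf_eq_sub_posPart_sub]

theorem sub_inf_posPart_inf_inf_posPart_sub_eq_zero {e : E} (he : 0 ≤ e) (t : E) :
    (e - e ⊓ t⁺) ⊓ (e ⊓ (t - e)⁺) = 0 := by
  rw [sub_inf_eq_posPart_sub]
  refine inf_eq_zero_of_le_of_le (posPart_nonneg _) (le_inf he (posPart_nonneg _)) le_rfl
    inf_le_right ?_
  rw [← posPart_posPart_sub he, posPart_sub_inf_posPart_sub_eq_zero]

variable [Module ℝ E]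

theorem smul_inf_eq_zero [PosSMulMono ℝ E] {x y : E} (h : x ⊓ y = 0) {c : ℝ} (hc : 0 ≤ c) :
    (c • x) ⊓ y = 0 := by
  have hx : 0 ≤ x := h ▸ inf_le_left
  have hy : 0 ≤ y := h ▸ inf_le_right
  have hc1 : 0 < c + 1 := by positivity
  refine inf_eq_zero_of_le_of_le (x' := (c + 1) • x) (y' := (c + 1) • y)
    (smul_nonneg hc hx) hy ?_ ?_ ?_
  · rw [add_smul, one_smul]
    exact le_add_of_nonneg_right hx
  · rw [add_smul, one_smul]
    exact le_add_of_nonneg_left (smul_nonneg hc hy)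
  · rw [← smul_zero (c + 1), ← h]
    exact ((OrderIso.smulRight hc1).map_inf x y).symm

theorem isLatticeHomomorphism_of_inf_eq_zero {F : Type v} [AddCommGroup F] [Lattice F]
    [IsOrderedAddMonoid F] [Module ℝ F] {T : E →ₗ[ℝ] F}
    (hT : ∀ x y, x ⊓ y = 0 → T x ⊓ T y = 0) : IsLatticeHomomorphism T := by
  have map_inf (x y : E) : T (x ⊓ y) = T x ⊓ T y := by
    have h := hT (x - x ⊓ y) (y - x ⊓ y) (by rw [← inf_sub, sub_self])
    rw [map_sub, map_sub, ← inf_sub, sub_eq_zero] at h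
    exact h.symm
  refine ⟨fun x y => ?_, map_inf⟩
  have h := congrArg T (inf_add_sup x y)
  rw [map_add, map_add, map_inf, ← inf_add_sup (T x) (T y)] at h
  exact add_left_cancel h

end RieszSpace

namespace OrdDual

variable {E : Type u} [AddCommGroup E] [Lattice E] [IsOrderedAddMonoid E] [Module ℝ E]

theorem isGLB_range_zero_of_tendsto_apply {ι : Type*} {l : Filter ι} [l.NeBot] {y : ι → OrdDual E}
    (hy : ∀ i, 0 ≤ y i) (h : ∀ x, 0 ≤ x → Tendsto (fun i => y i x) l (𝓝 0)) :
    IsGLB (range y) 0 :=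
  ⟨forall_mem_range.2 hy, fun _ hψ x hx =>
    ge_of_tendsto' (h x hx) fun i => hψ (mem_range_self i) x hx⟩

theorem tendsto_of_isGLB_range_zero {φ : OrdDual E} (hφ : φ ∈ orderContinuousFunctionals E)
    {ι : Type u} [Preorder ι] [IsDirectedOrder ι] [Nonempty ι] {y : ι → E} (hy : Antitone y)
    (hy0 : IsGLB (range y) 0) : Tendsto (fun i => φ (y i)) atTop (𝓝 0) := by
  have hconv : OrderConverges y 0 :=
    ⟨y, hy, hy0, fun i => by rw [sub_zero, abs_of_nonneg (hy0.1 (mem_range_self i))]⟩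
  obtain ⟨r, hr, hr0, hφr⟩ := hφ ι y hconv
  simp only [sub_zero] at hφr
  exact squeeze_zero_norm hφr (tendsto_atTop_isGLB hr hr0)

theorem tendsto_of_isGLB_range_zero_nat {φ : OrdDual E} (hφ : φ ∈ orderContinuousFunctionals E)
    {y : ℕ → E} (hy : Antitone y) (hy0 : IsGLB (range y) 0) :
    Tendsto (fun n => φ (y n)) atTop (𝓝 0) := by
  let e : ULift.{u} ℕ ≃o ℕ := ULift.orderIso
  have h := tendsto_of_isGLB_range_zero hφ (hy.comp_monotone e.monotone)
    (by rwa [e.surjective.range_comp])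
  exact h.comp e.symm.tendsto_atTop

theorem apply_partialSups_le {φ : OrdDual E} (hφ : 0 ≤ φ) {y : ℕ → E} (hy : ∀ n, 0 ≤ y n) (n : ℕ) :
    φ (partialSups y n) ≤ ∑ k ∈ Finset.range (n + 1), φ (y k) := by
  rw [← map_sum]
  exact mono hφ <| partialSups_le _ _ _ fun k hk =>
    Finset.single_le_sum (fun i _ => hy i) (Finset.mem_range_succ_iff.2 hk)

variable [PosSMulMono ℝ E]

theorem mem_orderContinuousFunctionals_of_le {φ ψ : OrdDual E}
    (hφ : φ ∈ orderContinuousFunctionals E) (hψ : 0 ≤ ψ) (hψφ : ψ ≤ φ) :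
    ψ ∈ orderContinuousFunctionals E := by
  rintro ι _ _ _ x ⟨y, hy, hy0, hxy⟩
  have hφ0 : 0 ≤ φ := hψ.trans hψφ
  have hφy : Antitone fun i => φ (y i) := fun i j h => mono hφ0 (hy h)
  refine ⟨_, hφy, isGLB_of_tendsto_atTop hφy (tendsto_of_isGLB_range_zero hφ hy hy0), fun i => ?_⟩
  calc |ψ (x i) - 0| ≤ |ψ| |x i| := by simpa only [sub_zero] using abs_apply_le ψ (x i)
    _ = ψ |x i| := by rw [abs_of_nonneg hψ]
    _ ≤ φ |x i| := hψφ _ (abs_nonneg _)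
    _ ≤ φ (y i) := mono hφ0 (by simpa only [sub_zero] using hxy i)

theorem inf_apply_le (φ ψ : OrdDual E) {x c : E} (hx : 0 ≤ x) (hxc : x ≤ c) :
    (φ ⊓ ψ) c ≤ φ x + ψ (c - x) :=
  calc (φ ⊓ ψ) c = (φ ⊓ ψ) x + (φ ⊓ ψ) (c - x) := by rw [← map_add, add_sub_cancel]
    _ ≤ φ x + ψ (c - x) := add_le_add ((inf_le_left : φ ⊓ ψ ≤ φ) x hx)
      ((inf_le_right : φ ⊓ ψ ≤ ψ) _ (sub_nonneg.2 hxc))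

theorem exists_apply_add_apply_lt (φ ψ : OrdDual E) {c : E} (hc : 0 ≤ c) {r : ℝ}
    (hr : (φ ⊓ ψ) c < r) : ∃ x ∈ Icc 0 c, φ x + ψ (c - x) < r := by
  by_contra! h
  have hpos : pos (φ - ψ) c ≤ φ c - r := pos_apply_le _ hc fun y hy hyc => by
    have := h (c - y) ⟨sub_nonneg.2 hyc, sub_le_self c hy⟩
    rw [sub_sub_cancel, map_sub] at this
    rw [sub_apply]
    linarith
  rw [inf_eq, sub_apply] at hr
  linarith

theorem inf_eq_zero_iff {φ ψ : OrdDual E} (hφ : 0 ≤ φ) (hψ : 0 ≤ ψ) :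
    φ ⊓ ψ = 0 ↔ ∀ c, 0 ≤ c → ∃ x : ℕ → E, (∀ n, x n ∈ Icc 0 c) ∧
      Tendsto (fun n => φ (x n)) atTop (𝓝 0) ∧ Tendsto (fun n => ψ (c - x n)) atTop (𝓝 0) := by
  refine ⟨fun h c hc => ?_, fun h => le_antisymm (fun c hc => ?_) (le_inf hφ hψ)⟩
  · have hex (n : ℕ) : ∃ x ∈ Icc 0 c, φ x + ψ (c - x) < 1 / ((n : ℝ) + 1) :=
      exists_apply_add_apply_lt φ ψ hc (by rw [h]; exact Nat.one_div_pos_of_nat)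
    choose x hx hlt using hex
    have hφx (n : ℕ) : 0 ≤ φ (x n) := hφ _ (hx n).1
    have hψx (n : ℕ) : 0 ≤ ψ (c - x n) := hψ _ (sub_nonneg.2 (hx n).2)
    have hlim := tendsto_one_div_add_atTop_nhds_zero_nat (𝕜 := ℝ)
    exact ⟨x, hx, squeeze_zero hφx (fun n => by linarith [hlt n, hψx n]) hlim,
      squeeze_zero hψx (fun n => by linarith [hlt n, hφx n]) hlim⟩
  · obtain ⟨x, hx, hφx, hψx⟩ := h c hc
    simpa only [add_zero, zero_apply] using
      ge_of_tendsto' (hφx.add hψx) fun n => inf_apply_le φ ψ (hx n).1 (hx n).2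

theorem exists_antitone_of_inf_eq_zero {φ ψ : OrdDual E} (h : φ ⊓ ψ = 0) {c : E} (hc : 0 ≤ c)
    {ε : ℝ} (hε : 0 < ε) : ∃ z : ℕ → E, Antitone z ∧ (∀ n, z n ∈ Icc 0 c) ∧
      Tendsto (fun n => φ (z n)) atTop (𝓝 0) ∧ ∀ n, ψ (c - z n) ≤ ε := by
  have hφ : 0 ≤ φ := h ▸ inf_le_left
  have hψ : 0 ≤ ψ := h ▸ inf_le_right
  have hex (n : ℕ) : ∃ x ∈ Icc 0 c, φ x + ψ (c - x) < ε / 2 * (1 / 2) ^ n :=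
    exists_apply_add_apply_lt φ ψ hc (by rw [h]; simp only [zero_apply]; positivity)
  choose x hx hlt using hex
  have hφx (n : ℕ) : 0 ≤ φ (x n) := hφ _ (hx n).1
  have hcx (n : ℕ) : 0 ≤ c - x n := sub_nonneg.2 (hx n).2
  have hψx (n : ℕ) : 0 ≤ ψ (c - x n) := hψ _ (hcx n)
  set w := partialSups fun n => c - x n
  have hwc (n : ℕ) : w n ≤ c := partialSups_le _ _ _ fun k _ => sub_le_self c (hx k).1
  have hxw (n : ℕ) : c - w n ≤ x n := sub_le_comm.1 (le_partialSups (fun n => c - x n) n)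
  have hgeom : Tendsto (fun n : ℕ => ε / 2 * (1 / 2) ^ n) atTop (𝓝 0) := by
    simpa only [mul_zero] using
      (tendsto_pow_atTop_nhds_zero_of_lt_one (by norm_num) (by norm_num)).const_mul (ε / 2)
  refine ⟨fun n => c - w n, fun i j hij => sub_le_sub_left (w.monotone hij) c,
    fun n => ⟨sub_nonneg.2 (hwc n), (hxw n).trans (hx n).2⟩,
    squeeze_zero (fun n => hφ _ (sub_nonneg.2 (hwc n)))
      (fun n => (mono hφ (hxw n)).trans (by linarith [hlt n, hψx n])) hgeom, fun n => ?_⟩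
  calc ψ (c - (c - w n)) = ψ (w n) := by rw [sub_sub_cancel]
    _ ≤ ∑ k ∈ Finset.range (n + 1), ψ (c - x k) := apply_partialSups_le hψ hcx n
    _ ≤ ∑ k ∈ Finset.range (n + 1), ε / 2 * (1 / 2) ^ k :=
      Finset.sum_le_sum fun k _ => by linarith [hlt k, hφx k]
    _ ≤ ε / 2 * 2 := by
      rw [← Finset.mul_sum]
      exact mul_le_mul_of_nonneg_left (sum_geometric_two_le (n + 1)) (by positivity)
    _ = ε := by ring

end OrdDual

theorem nonpos_of_forall_nsmul_le {α : Type*} [AddCommMonoid α] [LinearOrder α] [Archimedean α]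
    [IsOrderedCancelAddMonoid α] {x c : α} (h : ∀ n : ℕ, n • x ≤ c) : x ≤ 0 := by
  by_contra! hx
  obtain ⟨n, hn⟩ := exists_lt_nsmul hx c
  exact (h n).not_gt hn

/-- A bilinear form that is nonnegative on the positive cone and vanishes on disjoint pairs. The
forms `(a, b) ↦ f (a * b)` with `0 ≤ f` on an `f`-algebra are of this kind. -/
structure IsPositiveOrthosymmetric {E : Type u} [AddCommGroup E] [Lattice E] [Module ℝ E]
    (B : E →ₗ[ℝ] E →ₗ[ℝ] ℝ) : Prop where
  nonneg : ∀ x y, 0 ≤ x → 0 ≤ y → 0 ≤ B x y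
  eq_zero_of_inf_eq_zero : ∀ x y, x ⊓ y = 0 → B x y = 0

namespace IsPositiveOrthosymmetric

variable {E : Type u} [AddCommGroup E] [Lattice E] [Module ℝ E] {B : E →ₗ[ℝ] E →ₗ[ℝ] ℝ}

theorem flip (hB : IsPositiveOrthosymmetric B) : IsPositiveOrthosymmetric B.flip :=
  ⟨fun x y hx hy => hB.nonneg y x hy hx,
    fun x y h => hB.eq_zero_of_inf_eq_zero y x (inf_comm x y ▸ h)⟩

variable [IsOrderedAddMonoid E]

theorem apply_le_apply (hB : IsPositiveOrthosymmetric B) {x y z : E} (hx : 0 ≤ x) (hyz : y ≤ z) :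
    B x y ≤ B x z := by
  simpa only [map_sub, sub_nonneg] using hB.nonneg x (z - y) hx (sub_nonneg.2 hyz)

theorem apply_posPart_sub (hB : IsPositiveOrthosymmetric B) (x y : E) :
    B (x - y) (x - y)⁺ = B (x - y)⁺ (x - y)⁺ := by
  have hneg : B (x - y)⁻ (x - y)⁺ = 0 := hB.eq_zero_of_inf_eq_zero _ _ <| by
    rw [inf_comm, posPart_inf_negPart_eq_zero]
  rw [← sub_zero (B (x - y)⁺ (x - y)⁺), ← hneg, ← LinearMap.sub_apply, ← map_sub,
    posPart_sub_negPart]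

theorem abs_sub_flip_le (hB : IsPositiveOrthosymmetric B) {x y e : E} (hx : 0 ≤ x) (hy : 0 ≤ y)
    (hye : y ≤ e) : |B x y - B y x| ≤ B x e + B e x := by
  have h₁ := hB.nonneg x y hx hy
  have h₂ := hB.nonneg y x hy hx
  have h₃ : B x y ≤ B x e := hB.apply_le_apply hx hye
  have h₄ : B y x ≤ B e x := hB.flip.apply_le_apply hx hye
  exact abs_le.2 ⟨by linarith, by linarith⟩

theorem abs_sub_flip_le_of_sub_inf_eq_zero (hB : IsPositiveOrthosymmetric B) {e u v : E}
    (hv : 0 ≤ v) (hvu : v ≤ u) (hve : v ≤ e) (h : (e - u) ⊓ v = 0) :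
    |B e v - B v e| ≤ (B e u + B u e) - (B e v + B v e) := by
  have h₁ : B e v = B u v := by
    simpa only [map_sub, LinearMap.sub_apply, sub_eq_zero] using hB.eq_zero_of_inf_eq_zero _ _ h
  have h₂ : B v e = B v u := by
    simpa only [map_sub, sub_eq_zero] using hB.eq_zero_of_inf_eq_zero v (e - u) (inf_comm v _ ▸ h)
  have h₃ := hB.abs_sub_flip_le (sub_nonneg.2 hvu) hv hve
  simp only [map_sub, LinearMap.sub_apply, sub_sub_sub_cancel_right, ← h₁, ← h₂] at h₃
  linarith

/- `e ⊓ (b - k • e)⁺` is the part of `b` between the heights `k • e` and `(k + 1) • e`. Summing the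
bounds of `abs_sub_flip_le_of_sub_inf_eq_zero` over these slices telescopes. -/
theorem abs_sub_flip_sub_posPart_le (hB : IsPositiveOrthosymmetric B) {e b : E} (he : 0 ≤ e)
    (heb : e ≤ b) (n : ℕ) :
    |B e (b - (b - (n + 1) • e)⁺) - B (b - (b - (n + 1) • e)⁺) e| ≤
      2 * B e e - (B e (e ⊓ (b - n • e)⁺) + B (e ⊓ (b - n • e)⁺) e) := by
  induction n with
  | zero =>
    have hb : b - (b - e)⁺ = e := by rw [← inf_eq_sub_posPart_sub, inf_eq_right.2 heb]
    rw [zero_add, one_smul, zero_smul, sub_zero, hb, posPart_eq_self.2 (he.trans heb),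
      inf_eq_left.2 heb, sub_self, abs_zero]
    linarith
  | succ n ih =>
    have hsucc (k : ℕ) : b - (k + 1) • e = b - k • e - e := by
      rw [add_smul, one_smul, sub_sub]
    have hslice : b - (b - (n + 1 + 1) • e)⁺ =
        (b - (b - (n + 1) • e)⁺) + e ⊓ (b - (n + 1) • e)⁺ := by
      rw [inf_posPart_eq_posPart_sub_posPart he, sub_add_sub_cancel, hsucc (n + 1)]
    have hstep := hB.abs_sub_flip_le_of_sub_inf_eq_zero (le_inf he (posPart_nonneg _))
      (inf_le_inf_left e (posPart_mono (sub_le_self (b - n • e) he))) inf_le_left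
      (sub_inf_posPart_inf_inf_posPart_sub_eq_zero he (b - n • e))
    rw [← hsucc] at hstep
    simp only [hslice, map_add, LinearMap.add_apply, add_sub_add_comm]
    exact (abs_add_le _ _).trans (by linarith)

theorem nsmul_apply_posPart_le (hB : IsPositiveOrthosymmetric B) {a b : E} (ha : 0 ≤ a)
    (hb : 0 ≤ b) (n : ℕ) : n • B a (b - n • a)⁺ ≤ B b b := by
  have hle : (b - n • a)⁺ ≤ b := sup_le (sub_le_self b (nsmul_nonneg ha n)) hb
  have hnonneg : 0 ≤ B (b - n • a) (b - n • a)⁺ := by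
    rw [hB.apply_posPart_sub]
    exact hB.nonneg _ _ (posPart_nonneg _) (posPart_nonneg _)
  rw [map_sub, LinearMap.sub_apply, map_nsmul, LinearMap.smul_apply, sub_nonneg] at hnonneg
  exact hnonneg.trans (hB.apply_le_apply hb hle)

theorem abs_sub_flip_le_two_mul (hB : IsPositiveOrthosymmetric B) {e b : E} (he : 0 ≤ e)
    (heb : e ≤ b) : |B e b - B b e| ≤ 2 * B e e := by
  have hb : 0 ≤ b := he.trans heb
  refine sub_nonpos.1 (nonpos_of_forall_nsmul_le (c := 2 * B b b) fun n => ?_)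
  rcases n with _ | n
  · simpa using hB.nonneg b b hb hb
  set t := (b - (n + 1) • e)⁺
  have hslices : |B e (b - t) - B (b - t) e| ≤ 2 * B e e := by
    have hs : 0 ≤ e ⊓ (b - n • e)⁺ := le_inf he (posPart_nonneg _)
    have h := hB.abs_sub_flip_sub_posPart_le he heb n
    linarith [hB.nonneg e _ he hs, hB.nonneg _ e hs he]
  have htail : |B e t - B t e| ≤ B e t + B t e := by
    have h₁ := hB.nonneg e t he (posPart_nonneg _)
    have h₂ := hB.nonneg t e (posPart_nonneg _) he
    exact abs_le.2 ⟨by linarith, by linarith⟩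
  have hsplit : B e b - B b e = (B e (b - t) - B (b - t) e) + (B e t - B t e) := by
    simp only [map_sub, LinearMap.sub_apply]
    ring
  have hle : |B e b - B b e| - 2 * B e e ≤ B e t + B t e := by
    linarith [hsplit ▸ abs_add_le (B e (b - t) - B (b - t) e) (B e t - B t e)]
  calc (n + 1) • (|B e b - B b e| - 2 * B e e)
      ≤ (n + 1) • B e t + (n + 1) • B t e := (nsmul_le_nsmul_right hle _).trans_eq (nsmul_add _ _ _)
    _ ≤ B b b + B b b := add_le_add (hB.nsmul_apply_posPart_le he hb (n + 1))
      (hB.flip.nsmul_apply_posPart_le he hb (n + 1))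
    _ = 2 * B b b := (two_mul _).symm

theorem apply_comm_of_nonneg (hB : IsPositiveOrthosymmetric B) {a b : E} (ha : 0 ≤ a)
    (hb : 0 ≤ b) : B a b = B b a := by
  refine sub_eq_zero.1 (abs_nonpos_iff.1 (nonpos_of_forall_nsmul_le (c := 2 * B a a) fun n => ?_))
  -- Passing from `b` to `n • b + a` multiplies `B a b - B b a` by `n` but keeps the bound.
  have h := hB.abs_sub_flip_le_two_mul ha (le_add_of_nonneg_left (nsmul_nonneg hb n))
  simp only [map_add, map_nsmul, LinearMap.add_apply, LinearMap.smul_apply,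
    add_sub_add_right_eq_sub, ← nsmul_sub, abs_nsmul] at h
  exact h

theorem apply_comm (hB : IsPositiveOrthosymmetric B) (a b : E) : B a b = B b a := by
  rw [← posPart_sub_negPart a, ← posPart_sub_negPart b]
  simp only [map_sub, LinearMap.sub_apply,
    hB.apply_comm_of_nonneg (posPart_nonneg a) (posPart_nonneg b),
    hB.apply_comm_of_nonneg (posPart_nonneg a) (negPart_nonneg b),
    hB.apply_comm_of_nonneg (negPart_nonneg a) (posPart_nonneg b),
    hB.apply_comm_of_nonneg (negPart_nonneg a) (negPart_nonneg b)]
  ring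

end IsPositiveOrthosymmetric

namespace IsPositiveOrthosymmetric

variable {E : Type u} [AddCommGroup E] [Lattice E] [IsOrderedAddMonoid E] [Module ℝ E]
  [PosSMulMono ℝ E] {B : E →ₗ[ℝ] E →ₗ[ℝ] ℝ}

theorem exists_seq_of_inf_eq_zero (hB : IsPositiveOrthosymmetric B) {a b c : E} (hab : a ⊓ b = 0)
    (hc : 0 ≤ c) : ∃ x : ℕ → E, (∀ n, x n ∈ Icc 0 c) ∧ (∀ n, B a (x n) = 0) ∧
      Tendsto (fun n => B b (c - x n)) atTop (𝓝 0) := by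
  have ha : 0 ≤ a := hab ▸ inf_le_left
  have hb : 0 ≤ b := hab ▸ inf_le_right
  have hx (n : ℕ) : 0 ≤ c ⊓ n • b := le_inf hc (nsmul_nonneg hb n)
  have hdisj (n : ℕ) : a ⊓ (c ⊓ n • b) = 0 := by
    refine inf_eq_zero_of_le_of_le ha (hx n) le_rfl inf_le_right ?_
    rw [inf_comm, ← Nat.cast_smul_eq_nsmul ℝ]
    exact smul_inf_eq_zero (inf_comm a b ▸ hab) n.cast_nonneg
  refine ⟨fun n => c ⊓ n • b, fun n => ⟨hx n, inf_le_left⟩,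
    fun n => hB.eq_zero_of_inf_eq_zero _ _ (hdisj n), ?_⟩
  refine squeeze_zero' (.of_forall fun n => hB.nonneg _ _ hb (sub_nonneg.2 inf_le_left)) ?_
    (tendsto_const_div_atTop_nhds_zero_nat (B c c))
  filter_upwards [eventually_gt_atTop 0] with n hn
  rw [le_div_iff₀' (by exact_mod_cast hn), ← nsmul_eq_mul, sub_inf_eq_posPart_sub]
  exact hB.nsmul_apply_posPart_le hb hc n

end IsPositiveOrthosymmetric

/-- A positive operator on a Riesz space that is band preserving: `x ⊓ y = 0` implies
`T x ⊓ y = 0`. Multiplications by positive elements of an `f`-algebra are of this kind. -/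
structure IsPositiveOrthomorphism {E : Type u} [AddCommGroup E] [Lattice E] [Module ℝ E]
    (T : E →ₗ[ℝ] E) : Prop where
  nonneg : ∀ x, 0 ≤ x → 0 ≤ T x
  inf_eq_zero : ∀ x y, x ⊓ y = 0 → T x ⊓ y = 0

namespace IsPositiveOrthomorphism

variable {E : Type u} [AddCommGroup E] [Lattice E] [IsOrderedAddMonoid E] [Module ℝ E]
  {T : E →ₗ[ℝ] E}

theorem monotone (hT : IsPositiveOrthomorphism T) : Monotone T := fun x y h => by
  simpa only [map_sub, sub_nonneg] using hT.nonneg _ (sub_nonneg.2 h)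

theorem posPart_sub_le (hT : IsPositiveOrthomorphism T) {x v : E} (hx : 0 ≤ x) (hv : 0 ≤ v)
    (hvT : v ≤ T x) : (v - x)⁺ ≤ T (x ⊓ v) := by
  refine le_of_le_add_of_inf_eq_zero (z := T (x - x ⊓ v)) (hT.nonneg _ (le_inf hx hv)) ?_ ?_
  · rw [← map_add, add_sub_cancel]
    exact sup_le ((sub_le_self v hx).trans hvT) (hT.nonneg x hx)
  · rw [sub_inf_eq_posPart_sub, inf_comm]
    exact hT.inf_eq_zero _ _ (posPart_sub_inf_posPart_sub_eq_zero x v)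

variable [PosSMulMono ℝ E]

theorem smul_inf_posPart_le (hT : IsPositiveOrthomorphism T) {c : ℝ} (hc : 0 ≤ c) {x : E}
    (hx : 0 ≤ x) : c • (x ⊓ (T x - c • x)⁺) ≤ T x := by
  refine le_of_le_add_of_inf_eq_zero (z := (T x - c • x)⁻) (hT.nonneg x hx) ?_ ?_
  · calc c • (x ⊓ (T x - c • x)⁺) ≤ c • x := smul_le_smul_of_nonneg_left inf_le_left hc
      _ = T x + -(T x - c • x) := by rw [neg_sub, add_sub_cancel]
      _ ≤ T x + (T x - c • x)⁻ := add_le_add_right (neg_le_negPart _) _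
  · exact smul_inf_eq_zero (inf_eq_zero_of_le_of_le (le_inf hx (posPart_nonneg _))
      (negPart_nonneg _) inf_le_right le_rfl (posPart_inf_negPart_eq_zero _)) hc

theorem smul_apply_le (hT : IsPositiveOrthomorphism T) {c : ℝ} (hc : 0 ≤ c) {x : E} (hx : 0 ≤ x) :
    c • T x ≤ (c * c + c) • x + T (T x) := by
  set v := (T x - c • x)⁺
  have hvT : v ≤ T x := sup_le (sub_le_self _ (smul_nonneg hc hx)) (hT.nonneg x hx)
  have hTx : T x ≤ (c • x + x) + (v - x)⁺ := by
    calc T x = c • x + x + (T x - c • x - x) := by abel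
      _ ≤ c • x + x + (v - x)⁺ := add_le_add_right
        ((sub_le_sub_right (le_posPart _) x).trans (le_posPart _)) _
  have hTT : c • (v - x)⁺ ≤ T (T x) :=
    calc c • (v - x)⁺ ≤ c • T (x ⊓ v) :=
          smul_le_smul_of_nonneg_left (hT.posPart_sub_le hx (posPart_nonneg _) hvT) hc
      _ = T (c • (x ⊓ v)) := (map_smul T c _).symm
      _ ≤ T (T x) := hT.monotone (hT.smul_inf_posPart_le hc hx)
  calc c • T x ≤ c • ((c • x + x) + (v - x)⁺) := smul_le_smul_of_nonneg_left hTx hc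
    _ = (c * c + c) • x + c • (v - x)⁺ := by rw [smul_add, smul_add, smul_smul, add_smul]
    _ ≤ (c * c + c) • x + T (T x) := add_le_add_right hTT _

theorem tendsto_apply (hT : IsPositiveOrthomorphism T) {φ : OrdDual E} (hφ : 0 ≤ φ) {ι : Type*}
    {l : Filter ι} {x : ι → E} {c : E} (hx : ∀ i, x i ∈ Icc 0 c)
    (h : Tendsto (fun i => φ (x i)) l (𝓝 0)) : Tendsto (fun i => φ (T (x i))) l (𝓝 0) := by
  have hbound (i : ι) {k : ℝ} (hk : 0 ≤ k) :
      k * φ (T (x i)) ≤ (k * k + k) * φ (x i) + φ (T (T c)) := by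
    have h₁ := OrdDual.mono hφ (hT.smul_apply_le hk (hx i).1)
    simp only [map_add, map_smul, smul_eq_mul] at h₁
    exact h₁.trans (by gcongr; exact OrdDual.mono hφ (hT.monotone (hT.monotone (hx i).2)))
  rw [tendsto_order]
  refine ⟨fun r hr => .of_forall fun i => hr.trans_le (hφ _ (hT.nonneg _ (hx i).1)),
    fun r hr => ?_⟩
  obtain ⟨k, hk⟩ := exists_nat_gt (φ (T (T c)) / r)
  rw [div_lt_iff₀ hr] at hk
  have hlim : Tendsto (fun i => ((k : ℝ) * k + k) * φ (x i)) l (𝓝 0) := by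
    simpa only [mul_zero] using h.const_mul ((k : ℝ) * k + k)
  filter_upwards [hlim.eventually_lt_const (show 0 < k * r - φ (T (T c)) by linarith)] with i hi
  have := hbound i k.cast_nonneg
  exact lt_of_mul_lt_mul_left (by linarith : k * φ (T (x i)) < k * r) k.cast_nonneg

theorem orderAdjoint (hT : IsPositiveOrthomorphism T) (hT' : IsOrderBounded T) :
    IsPositiveOrthomorphism (orderAdjoint T hT') where
  nonneg φ hφ x hx := hφ (T x) (hT.nonneg x hx)
  inf_eq_zero φ ψ h := by
    have hφ : 0 ≤ φ := h ▸ inf_le_left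
    have hψ : 0 ≤ ψ := h ▸ inf_le_right
    have hφT : 0 ≤ _root_.orderAdjoint T hT' φ := fun x hx => hφ (T x) (hT.nonneg x hx)
    refine (OrdDual.inf_eq_zero_iff hφT hψ).2 fun c hc => ?_
    obtain ⟨x, hx, hφx, hψx⟩ := (OrdDual.inf_eq_zero_iff hφ hψ).1 h c hc
    exact ⟨x, hx, hT.tendsto_apply hφ hx hφx, hψx⟩

end IsPositiveOrthomorphism

namespace FAlgebra

variable {A : Type u} [NonUnitalRing A] [Lattice A] [Module ℝ A] [FAlgebra A]

theorem mul_eq_zero_of_inf_eq_zero {a b : A} (h : a ⊓ b = 0) : a * b = 0 := by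
  have ha : 0 ≤ a := h ▸ inf_le_left
  have hb : 0 ≤ b := h ▸ inf_le_right
  have hab : b ⊓ (a * b) = 0 := inf_comm b _ ▸ inf_mul_eq_zero a b b h hb
  simpa only [inf_idem] using mul_inf_eq_zero b (a * b) a hab ha

theorem isPositiveOrthomorphism_mulLeft {a : A} (ha : 0 ≤ a) :
    IsPositiveOrthomorphism (LinearMap.mulLeft ℝ a) :=
  ⟨fun x hx => mul_nonneg a x ha hx, fun x y h => mul_inf_eq_zero x y a h ha⟩

theorem isPositiveOrthomorphism_mulRight {a : A} (ha : 0 ≤ a) :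
    IsPositiveOrthomorphism (LinearMap.mulRight ℝ a) :=
  ⟨fun x hx => mul_nonneg x a hx ha, fun x y h => inf_mul_eq_zero x y a h ha⟩

theorem isPositiveOrthosymmetric_mul {f : OrdDual A} (hf : 0 ≤ f) :
    IsPositiveOrthosymmetric ((LinearMap.mul ℝ A).compr₂ f.toLin) where
  nonneg a b ha hb := hf _ (mul_nonneg a b ha hb)
  eq_zero_of_inf_eq_zero a b h := by
    rw [LinearMap.compr₂_apply, LinearMap.mul_apply', mul_eq_zero_of_inf_eq_zero h, map_zero]

theorem apply_mul_comm (f : OrdDual A) (a b : A) : f (a * b) = f (b * a) := by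
  have hpos : f⁺ (a * b) = f⁺ (b * a) :=
    (isPositiveOrthosymmetric_mul (posPart_nonneg f)).apply_comm a b
  have hneg : f⁻ (a * b) = f⁻ (b * a) :=
    (isPositiveOrthosymmetric_mul (negPart_nonneg f)).apply_comm a b
  rw [← posPart_sub_negPart f, OrdDual.sub_apply, OrdDual.sub_apply, hpos, hneg]

end FAlgebra

namespace OrdDual

variable {E : Type u} {F : Type v} [AddCommGroup E] [Lattice E] [IsOrderedAddMonoid E] [Module ℝ E]
  [AddCommGroup F] [Lattice F] [IsOrderedAddMonoid F] [Module ℝ F] [PosSMulMono ℝ F]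

theorem exists_extension_of_le_apply_posPart {φ : OrdDual F} (hφ : 0 ≤ φ) (p : Submodule ℝ F)
    (g : F →ₗ[ℝ] ℝ) (hg : ∀ y ∈ p, g y ≤ φ y⁺) : ∃ ψ ∈ Icc 0 φ, ∀ y ∈ p, ψ y = g y := by
  have posPart_smul (c : ℝ) (hc : 0 < c) (y : F) : φ (c • y)⁺ = c * φ y⁺ := by
    have h : c • (y ⊔ 0) = c • y ⊔ c • 0 := (OrderIso.smulRight hc).map_sup y 0
    rw [posPart_def, posPart_def, ← smul_eq_mul, ← map_smul, h, smul_zero]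
  have posPart_add (y z : F) : φ (y + z)⁺ ≤ φ y⁺ + φ z⁺ := by
    rw [← map_add]
    exact mono hφ (sup_le (add_le_add (le_posPart y) (le_posPart z))
      (add_nonneg (posPart_nonneg y) (posPart_nonneg z)))
  obtain ⟨ψ, hψg, hψφ⟩ := exists_extension_of_le_sublinear (g.toPMap p) (fun y => φ y⁺)
    posPart_smul posPart_add fun y => hg y y.2
  have hψ0 (y : F) (hy : 0 ≤ y) : 0 ≤ ψ y := by
    have h := hψφ (-y)
    rwa [map_neg, posPart_eq_zero.2 (neg_nonpos.2 hy), map_zero, neg_nonpos] at h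
  exact ⟨mk ψ (isOrderBounded_of_nonneg ψ hψ0),
    ⟨hψ0, fun y hy => (hψφ y).trans_eq (by rw [posPart_eq_self.2 hy])⟩, fun y hy => hψg ⟨y, hy⟩⟩

theorem exists_orderAdjoint_eq_of_le {T : E →ₗ[ℝ] F} (hT : IsLatticeHomomorphism T)
    (hT' : IsOrderBounded T) {φ : OrdDual F} (hφ : 0 ≤ φ) {g : OrdDual E} (hg : 0 ≤ g)
    (hgφ : g ≤ orderAdjoint T hT' φ) : ∃ ψ ∈ Icc 0 φ, orderAdjoint T hT' ψ = g := by
  have hgT (x : E) : g x ≤ φ (T x)⁺ :=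
    calc g x ≤ g x⁺ := mono hg (le_posPart x)
      _ ≤ φ (T x⁺) := hgφ _ (posPart_nonneg x)
      _ = φ (T x)⁺ := by rw [posPart_def, hT.map_sup, map_zero, ← posPart_def]
  have hker : g.toLin ∈ T.ker.dualAnnihilator := by
    refine (Submodule.mem_dualAnnihilator _).2 fun x hx => ?_
    rw [LinearMap.mem_ker] at hx
    have h₁ := hgT x
    have h₂ := hgT (-x)
    simp only [map_neg, hx, neg_zero, posPart_zero, map_zero] at h₁ h₂
    linarith
  rw [← LinearMap.range_dualMap_eq_dualAnnihilator_ker] at hker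
  obtain ⟨g', hg'⟩ := hker
  have hg'T (x : E) : g' (T x) = g x := LinearMap.congr_fun hg' x
  obtain ⟨ψ, hψ, hψg'⟩ := exists_extension_of_le_apply_posPart hφ T.range g' <| by
    rintro _ ⟨x, rfl⟩
    exact (hg'T x).trans_le (hgT x)
  exact ⟨ψ, hψ, ext_nonneg fun x _ => (hψg' (T x) (LinearMap.mem_range_self T x)).trans (hg'T x)⟩

end OrdDual

section Bidual

variable {A : Type u} [NonUnitalRing A] [Lattice A] [Module ℝ A] [FAlgebra A]

theorem dualMul_nonneg {f : OrdDual A} (hf : 0 ≤ f) {a : A} (ha : 0 ≤ a) : 0 ≤ dualMul f a :=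
  fun b hb => hf (a * b) (FAlgebra.mul_nonneg a b ha hb)

theorem isLatticeHomomorphism_dualMulMap {f : OrdDual A} (hf : 0 ≤ f) :
    IsLatticeHomomorphism (dualMulMap f) := by
  refine isLatticeHomomorphism_of_inf_eq_zero fun a b hab => ?_
  refine (OrdDual.inf_eq_zero_iff (dualMul_nonneg hf (hab ▸ inf_le_left))
    (dualMul_nonneg hf (hab ▸ inf_le_right))).2 fun c hc => ?_
  obtain ⟨x, hx, hax, hbx⟩ :=
    (FAlgebra.isPositiveOrthosymmetric_mul hf).exists_seq_of_inf_eq_zero hab hc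
  exact ⟨x, hx, tendsto_const_nhds.congr fun n => (hax n).symm, hbx⟩

theorem bidualMul_add (F : OrdContDual (OrdDual A)) (f g : OrdDual A) :
    bidualMul F (f + g) = bidualMul F f + bidualMul F g :=
  OrdDual.ext_nonneg fun a _ => map_add (OrdContDual.incl _ F).toLin (dualMul f a) (dualMul g a)

theorem bidualMul_mono {F : OrdContDual (OrdDual A)} (hF : 0 ≤ F) : Monotone (bidualMul F) :=
  fun _ _ hfg a ha => OrdDual.mono hF fun b hb => hfg (a * b) (FAlgebra.mul_nonneg a b ha hb)

theorem bidualMul_nonneg {F : OrdContDual (OrdDual A)} (hF : 0 ≤ F) {f : OrdDual A} (hf : 0 ≤ f) :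
    0 ≤ bidualMul F f :=
  fun _ ha => hF _ (dualMul_nonneg hf ha)

theorem tendsto_bidualMul_apply {F : OrdContDual (OrdDual A)} (hF : 0 ≤ F) {ι : Type*}
    {l : Filter ι} {g : ι → OrdDual A} {f : OrdDual A} (hg : ∀ i, g i ∈ Icc 0 f)
    (h : Tendsto (fun i => OrdContDual.incl _ F (g i)) l (𝓝 0)) {a : A} (ha : 0 ≤ a) :
    Tendsto (fun i => bidualMul F (g i) a) l (𝓝 0) :=
  ((FAlgebra.isPositiveOrthomorphism_mulLeft ha).orderAdjoint
    (isOrderBounded_mulLeft a)).tendsto_apply hF hg h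

theorem isGLB_range_dualMul_zero {p : OrdDual A} (hp : 0 ≤ p) {z : ℕ → A} {c : A}
    (hz : ∀ n, z n ∈ Icc 0 c) (h : Tendsto (fun n => p (z n)) atTop (𝓝 0)) :
    IsGLB (range fun n => dualMul p (z n)) 0 :=
  OrdDual.isGLB_range_zero_of_tendsto_apply
    (fun n => dualMul_nonneg hp (hz n).1)
    fun _ hb => (FAlgebra.isPositiveOrthomorphism_mulRight hb).tendsto_apply hp hz h

theorem bidualMul_inf_eq_zero {F : OrdContDual (OrdDual A)} (hF : 0 ≤ F) {p q : OrdDual A}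
    (h : p ⊓ q = 0) : bidualMul F p ⊓ q = 0 := by
  have hp : 0 ≤ p := h ▸ inf_le_left
  have hq : 0 ≤ q := h ▸ inf_le_right
  refine le_antisymm (fun c hc => le_of_forall_pos_le_add fun ε hε => ?_)
    (le_inf (bidualMul_nonneg hF hp) hq)
  obtain ⟨z, hz, hzc, hpz, hqz⟩ := OrdDual.exists_antitone_of_inf_eq_zero h hc hε
  have hanti : Antitone fun n => dualMul p (z n) := fun m n hmn b hb => OrdDual.mono hp <|
    (FAlgebra.isPositiveOrthomorphism_mulRight hb).monotone (hz hmn)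
  have hlim : Tendsto (fun n => bidualMul F p (z n)) atTop (𝓝 0) :=
    OrdDual.tendsto_of_isGLB_range_zero_nat F.2 hanti (isGLB_range_dualMul_zero hp hzc hpz)
  exact ge_of_tendsto' (hlim.add_const ε) fun n =>
    (OrdDual.inf_apply_le _ _ (hzc n).1 (hzc n).2).trans (add_le_add_right (hqz n) _)

theorem bidualMul_add_inf_bidualMul_add_le {F G : OrdContDual (OrdDual A)} (hF : 0 ≤ F)
    (hG : 0 ≤ G) {g h : OrdDual A} (hg : 0 ≤ g) (hh : 0 ≤ h) :
    bidualMul F (g + h) ⊓ bidualMul G (g + h) ≤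
      bidualMul F g + bidualMul F g + (bidualMul G h + bidualMul G h) := by
  have hdisj : bidualMul F (h - g)⁺ ⊓ bidualMul G (g - h)⁺ = 0 := by
    refine bidualMul_inf_eq_zero hF ?_
    rw [inf_comm]
    exact bidualMul_inf_eq_zero hG (posPart_sub_inf_posPart_sub_eq_zero g h)
  have hle {H : OrdContDual (OrdDual A)} (hH : 0 ≤ H) (u v : OrdDual A) :
      bidualMul H (u + v) ≤ bidualMul H u + bidualMul H u + bidualMul H (v - u)⁺ := by
    rw [← bidualMul_add, ← bidualMul_add]
    refine bidualMul_mono hH ?_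
    calc u + v = u + u + (v - u) := by abel
      _ ≤ u + u + (v - u)⁺ := add_le_add_right (le_posPart _) _
  have hFg : 0 ≤ bidualMul F g + bidualMul F g :=
    add_nonneg (bidualMul_nonneg hF hg) (bidualMul_nonneg hF hg)
  have hGh : 0 ≤ bidualMul G h + bidualMul G h :=
    add_nonneg (bidualMul_nonneg hG hh) (bidualMul_nonneg hG hh)
  refine sub_nonpos.1 ((le_inf (sub_le_iff_le_add'.2 ?_) (sub_le_iff_le_add'.2 ?_)).trans_eq hdisj)
  · exact inf_le_left.trans ((hle hF g h).trans
      (add_le_add_left (le_add_of_nonneg_right hGh) _))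
  · exact inf_le_right.trans ((add_comm g h ▸ hle hG h g).trans
      (add_le_add_left (le_add_of_nonneg_left hFg) _))

theorem bidualMul_inf_bidualMul_eq_zero {f : OrdDual A} (hf : 0 ≤ f)
    {F G : OrdContDual (OrdDual A)} (h : F ⊓ G = 0) : bidualMul F f ⊓ bidualMul G f = 0 := by
  have hF : 0 ≤ F := h ▸ inf_le_left
  have hG : 0 ≤ G := h ▸ inf_le_right
  refine le_antisymm (fun a ha => ?_) (le_inf (bidualMul_nonneg hF hf) (bidualMul_nonneg hG hf))
  obtain ⟨g, hg, hFg, hGg⟩ :=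
    (OrdDual.inf_eq_zero_iff hF hG).1 (congrArg (OrdContDual.incl _) h) f hf
  have hfg (n : ℕ) : f - g n ∈ Icc 0 f := ⟨sub_nonneg.2 (hg n).2, sub_le_self f (hg n).1⟩
  have hFlim := tendsto_bidualMul_apply hF hg hFg ha
  have hGlim := tendsto_bidualMul_apply hG hfg hGg ha
  have hlim := (hFlim.add hFlim).add (hGlim.add hGlim)
  simp only [add_zero] at hlim
  refine ge_of_tendsto' hlim fun n => ?_
  have := bidualMul_add_inf_bidualMul_add_le hF hG (hg n).1 (hfg n).1 a ha
  rwa [add_sub_cancel] at this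

theorem isLatticeHomomorphism_bidualMulMap {f : OrdDual A} (hf : 0 ≤ f) :
    IsLatticeHomomorphism (bidualMulMap f) :=
  isLatticeHomomorphism_of_inf_eq_zero fun _ _ h => bidualMul_inf_bidualMul_eq_zero hf h

theorem isIntervalPreserving_bidualMulMap {f : OrdDual A} (hf : 0 ≤ f) :
    IsIntervalPreserving (bidualMulMap f) where
  nonneg _ hF := bidualMul_nonneg hF hf
  image_Icc F hF := by
    refine Subset.antisymm (image_subset_iff.2 fun G hG => ⟨bidualMul_nonneg hG.1 hf,
      fun a ha => hG.2 _ (dualMul_nonneg hf ha)⟩) ?_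
    rintro g ⟨hg, hgF⟩
    obtain ⟨ψ, ⟨hψ, hψF⟩, rfl⟩ := OrdDual.exists_orderAdjoint_eq_of_le
      (isLatticeHomomorphism_dualMulMap hf) (isOrderBounded_dualMulMap f) hF hg hgF
    exact ⟨⟨ψ, OrdDual.mem_orderContinuousFunctionals_of_le F.2 hψ hψF⟩, ⟨hψ, hψF⟩, rfl⟩

end Bidual

theorem theorem2p1_general {A : Type u} [NonUnitalRing A] [Lattice A] [Module ℝ A] [FAlgebra A]
    (f : OrdDual A) (hf : 0 ≤ f) :
    IsIntervalPreserving (bidualMulMap f) ∧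
    IsLatticeHomomorphism (bidualMulMap f) ∧
    (∀ a : A, bidualMulMap f (canonicalEmbedding a) = dualMulMap f a) ∧
    IsOrderBounded (dualMulMap f) ∧
    (∀ (hS : IsOrderBounded (dualMulMap f)) (F : OrdContDual (OrdDual A)),
      bidualMulMap f F = orderAdjoint (dualMulMap f) hS (OrdContDual.incl _ F)) :=
  ⟨isIntervalPreserving_bidualMulMap hf, isLatticeHomomorphism_bidualMulMap hf,
    fun a => OrdDual.ext_nonneg fun b _ => FAlgebra.apply_mul_comm f b a,
    isOrderBounded_dualMulMap f, fun _ _ => rfl⟩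

theorem theorem2p1 {A : Type u} [NonUnitalRing A] [Lattice A] [Module ℝ A] [FAlgebra A]
    (hA : HasSeparatingOrderDual A) (f : OrdDual A) (hf : 0 ≤ f) :
    IsIntervalPreserving (bidualMulMap f) ∧
    IsLatticeHomomorphism (bidualMulMap f) ∧
    (∀ a : A, bidualMulMap f (canonicalEmbedding a) = dualMulMap f a) ∧
    IsOrderBounded (dualMulMap f) ∧
    (∀ (hS : IsOrderBounded (dualMulMap f)) (F : OrdContDual (OrdDual A)),
      bidualMulMap f F = orderAdjoint (dualMulMap f) hS (OrdContDual.incl _ F)) :=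
  theorem2p1_general f hf
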